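/- A three-step path is a lattice path consisting of up-steps $(1,1)$, level steps $(1,0)$ and down-steps $(1,-1)$. For non-negative integers $m,k$ let $MP_m(k)$ denote the number of three-step paths with $m$ steps that start at $(0,k)$, never run below the $x$-axis, and have arbitrary end point. For integers $a,b$ let $\binom{m}{a,b}=\frac{m!}{a!\,b!\,(m-a-b)!}$, which is understood to be $0$ if one of $a$, $b$, $m-a-b$ is negative. Then, for all positive integers $n$ and non-negative integers $k$, $$\det_{0\le i,j\le n-1}\bigl(MP_{i+j+1}(k)\bigr)=\det_{0\le i,j\le n-1}\left(\sum_{\ell\ge0}\sum_{l=-k}^{k+1}\binom{i+j+1}{\ell,\ell+l}\right)$$ $$=\begin{cases} (-1)^{n_1\binom{k+2}2}, & \text{if } n=(k+1)n_1 \text{ and } k\equiv2\pmod 3,\\ (-1)^{n_1\binom{k+2}2}, & \text{if } n=(3k+3)n_1 \text{ and } k\not\equiv2\pmod 3,\\ 2(-1)^{(n_1+1)\binom{k+2}2+1}, & \text{if } n=(3k+3)n_1+k+1 \text{ and } k\not\equiv2\pmod 3,\\ (-1)^{n_1\binom{k+2}2}, & \text{if } n=(3k+3)n_1+2k+2 \text{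 and } k\not\equiv2\pmod 3,\\ 3(-1)^{n_1\binom{k+2}2}(n_1+1), & \text{if } n=(k+1)n_1+1 \text{ and } k\equiv2\pmod 3,\\ 3(-1)^{n_1\binom{k+2}2}, & \text{if } n=(3k+3)n_1+1 \text{ and } k\not\equiv2\pmod 3,\\ 3(-1)^{(n_1+1)\binom{k+2}2+1}, & \text{if } n=(3k+3)n_1+k+2 \text{ and } k\not\equiv2\pmod 3,\\ 3(-1)^{(n_1+1)\binom{k+2}2+1}(n_1+1), & \text{if } n=(k+1)n_1+k \text{ and } k\equiv2\pmod 3,\\ 3(-1)^{(n_1+1)\binom{k+2}2+1}, & \text{if } n=(3k+3)n_1+k \text{ and } k\not\equiv2\pmod 3,\\ 3(-1)^{n_1\binom{k+2}2}, & \text{if } n=(3k+3)n_1+2k+1 \text{ and } k\not\equiv2\pmod 3,\\ 0, & \text{otherwise,} \end{cases}$$ where $n_1$ denotes a non-negative integer and where, if several cases apply (which happens only for $k\in\{0,1\}$), the first applicable one is to be taken. -/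

import Mathlib

/-- The height after the first `m` steps of the three-step path with `n` steps that starts at
height `k` and whose `i`-th step is `(1, s i)`; here `SignType` is the set `{-1, 0, 1}`, so that
the steps are the down-step, the level step and the up-step. -/
def pathHeight (k : ℕ) {n : ℕ} (s : Fin n → SignType) (m : ℕ) : ℤ :=
  (k : ℤ) + ∑ i ∈ Finset.univ.filter (fun i : Fin n => i.val < m), (s i : ℤ)

/-- The generalised Motzkin prefix number `MP_n(k)`: the number of three-step paths with `n` steps
that start at `(0, k)`, end at any height, and never run below the `x`-axis. -/
def motzkinPrefix (n k : ℕ) : ℕ :=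
  Fintype.card {s : Fin n → SignType // ∀ m : Fin (n + 1), 0 ≤ pathHeight k s m}

/-- The trinomial coefficient `n! / (a! b! (n - a - b)!)`, which is zero as soon as one of
`a`, `b`, `n - a - b` is negative. (The division of natural numbers is exact.) -/
def trinomial (n : ℕ) (a b : ℤ) : ℕ :=
  if 0 ≤ a ∧ 0 ≤ b ∧ a + b ≤ n then
    n.factorial / (a.toNat.factorial * b.toNat.factorial * ((n : ℤ) - a - b).toNat.factorial)
  else 0

/-- The sum `∑_{r ≥ 0} ∑_{l = -k}^{k + 1}` of the trinomial coefficients of `n` with lower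
entries `r` and `r + l`. -/
noncomputable def trinomialSum (n k : ℕ) : ℕ :=
  ∑ᶠ r : ℕ, ∑ l ∈ Finset.Icc (-(k : ℤ)) ((k : ℤ) + 1), trinomial n (r : ℤ) ((r : ℤ) + l)

/-- The sum over `r` has only finitely many non-zero terms. -/
theorem trinomialSum_support_finite (n k : ℕ) :
    (Function.support fun r : ℕ =>
      ∑ l ∈ Finset.Icc (-(k : ℤ)) ((k : ℤ) + 1), trinomial n (r : ℤ) ((r : ℤ) + l)).Finite := by
  refine (Finset.range (n + 1)).finite_toSet.subset fun r hr => ?_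
  by_contra hlt
  refine hr (Finset.sum_eq_zero fun l _ => ?_)
  have : n < r := by simpa using hlt
  unfold trinomial
  rw [if_neg]
  omega

/-! Splitting off the first step gives a three-term recurrence in the starting height, which a
reflection argument matches with the trinomial sums; this settles the first equality. For the
evaluation, let `L` be the functional with moments `pathCount m 0`. The recurrence says `L (S_k(x-1)
X^m) = pathCount m k`, so the monic polynomials `V_n = S_n(x-1) - S_{n-1}(x-1)` are orthogonal of
norm one, and the matrix in question is the Hankel matrix of `L` multiplied by `X * S_k(x-1)`, of
degree `d = k + 1`. By `det_hankel_mul` its determinant is, up to sign, the `d × d` determinant of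
the coordinates of `V_n, …, V_{n+d-1}` modulo that polynomial in the basis `V_0, …, V_{d-1}`.
Chebyshev identities fold the index of `V` into `{0, …, d-1}` by reflections, at the price of a
multiple of `S_{d-1}(x-1) = V_0 + … + V_{d-1}`. The small matrix is thus a 0/1 matrix with a single
1 per row plus a rank-one matrix. With `n = d q + r`, the folded indices form a permutation for `r =
0`, repeat one value for `r = 1` or `r = k`, and repeat two values otherwise, when the determinant
vanishes. The period 3 comes from `x - 1 = 2 cos (2π/3)` at `x = 0`. -/

/-! ### Path counts and their recurrence. -/

/-- The number of three-step paths with `m` steps that start at height `h` and never become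
negative. -/
def pathCount (m : ℕ) (h : ℤ) : ℕ :=
  Fintype.card {s : Fin m → SignType //
    ∀ j : Fin (m + 1), 0 ≤ h + ∑ i ∈ Finset.univ.filter (fun i : Fin m => i.val < j.val), (s i : ℤ)}

theorem motzkinPrefix_eq_pathCount (m k : ℕ) : motzkinPrefix m k = pathCount m k := rfl

theorem pathCount_of_neg (m : ℕ) {h : ℤ} (hh : h < 0) : pathCount m h = 0 := by
  rw [pathCount, Fintype.card_eq_zero_iff]
  refine ⟨fun s => ?_⟩
  have := s.2 0
  simp at this
  omega

theorem pathCount_zero {h : ℤ} (hh : 0 ≤ h) : pathCount 0 h = 1 := by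
  rw [pathCount, Fintype.card_eq_one_iff]
  exact ⟨⟨Fin.elim0, fun j => by simpa using hh⟩, fun y => Subtype.ext (Subsingleton.elim _ _)⟩

theorem sum_filter_cons {m : ℕ} (a : SignType) (s : Fin m → SignType) (j : ℕ) :
    ∑ i ∈ Finset.univ.filter (fun i : Fin (m + 1) => i.val < j + 1),
      ((Fin.cons a s : Fin (m + 1) → SignType) i : ℤ) =
      a + ∑ i ∈ Finset.univ.filter (fun i : Fin m => i.val < j), (s i : ℤ) := by
  simp [Finset.sum_filter, Fin.sum_univ_succ]

theorem pathCount_succ (m : ℕ) {h : ℤ} (hh : 0 ≤ h) :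
    pathCount (m + 1) h = pathCount m (h - 1) + pathCount m h + pathCount m (h + 1) := by
  have key : pathCount (m + 1) h = ∑ a : SignType, pathCount m (h + a) := by
    unfold pathCount
    rw [← Fintype.card_sigma]
    refine Fintype.card_congr
      { toFun := fun s => ⟨s.1 0, Fin.tail s.1, fun j => ?_⟩
        invFun := fun p => ⟨Fin.cons p.1 p.2.1, fun j => ?_⟩
        left_inv := fun s => Subtype.ext (Fin.cons_self_tail _)
        right_inv := fun _ => rfl }
    · have := s.2 j.succ
      rw [← Fin.cons_self_tail s.1, Fin.val_succ, sum_filter_cons] at this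
      simpa [add_assoc] using this
    · refine Fin.cases (by simpa using hh) (fun j => ?_) j
      have := p.2.2 j
      rw [Fin.val_succ, sum_filter_cons]
      simpa [add_assoc] using this
  rw [key]
  have : (Finset.univ : Finset SignType) = {0, -1, 1} := by decide
  rw [this, Finset.sum_insert (by decide), Finset.sum_insert (by decide), Finset.sum_singleton]
  simp [← sub_eq_add_neg]
  omega

/-! ### Trinomial coefficients and the reflection principle. -/

theorem trinomial_natCast (n a b : ℕ) :
    trinomial n a b = n.choose (a + b) * (a + b).choose a := by
  unfold trinomial
  split_ifs with h
  · have hab : a + b ≤ n := by omega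
    have e : ((n : ℤ) - a - b).toNat = n - (a + b) := by omega
    rw [e, Int.toNat_natCast, Int.toNat_natCast]
    refine Nat.div_eq_of_eq_mul_left (by positivity) ?_
    have h1 := Nat.choose_mul_factorial_mul_factorial hab
    have h2 := Nat.choose_mul_factorial_mul_factorial (Nat.le_add_right a b)
    rw [Nat.add_sub_cancel_left] at h2
    rw [← h1, ← h2]
    ring
  · rw [Nat.choose_eq_zero_of_lt (by omega), zero_mul]

theorem trinomial_of_neg_left (n : ℕ) {a : ℤ} (b : ℤ) (ha : a < 0) : trinomial n a b = 0 :=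
  if_neg (by omega)

theorem trinomial_of_neg_right (n : ℕ) (a : ℤ) {b : ℤ} (hb : b < 0) : trinomial n a b = 0 :=
  if_neg (by omega)

theorem trinomial_of_lt {n : ℕ} {a : ℤ} (b : ℤ) (ha : n < a) : trinomial n a b = 0 :=
  if_neg (by omega)

theorem trinomial_succ (n : ℕ) (a b : ℤ) :
    trinomial (n + 1) a b = trinomial n (a - 1) b + trinomial n a (b - 1) + trinomial n a b := by
  rcases lt_or_ge a 0 with ha | ha
  · simp only [trinomial_of_neg_left _ _ ha, trinomial_of_neg_left _ _ (show a - 1 < 0 by omega)]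
  rcases lt_or_ge b 0 with hb | hb
  · simp only [trinomial_of_neg_right _ _ hb, trinomial_of_neg_right _ _ (show b - 1 < 0 by omega)]
  lift a to ℕ using ha
  lift b to ℕ using hb
  rcases a with _ | a <;> rcases b with _ | b
  · have h0 : trinomial n (((0 : ℕ) : ℤ) - 1) ((0 : ℕ) : ℤ) = 0 :=
      trinomial_of_neg_left _ _ (by simp)
    have h1 : trinomial n ((0 : ℕ) : ℤ) (((0 : ℕ) : ℤ) - 1) = 0 :=
      trinomial_of_neg_right _ _ (by simp)
    rw [h0, h1, trinomial_natCast, trinomial_natCast]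
    simp
  · have h0 : trinomial n (((0 : ℕ) : ℤ) - 1) ((b + 1 : ℕ) : ℤ) = 0 :=
      trinomial_of_neg_left _ _ (by simp)
    have e : ((b + 1 : ℕ) : ℤ) - 1 = (b : ℕ) := by push_cast; ring
    rw [h0, e, trinomial_natCast, trinomial_natCast, trinomial_natCast]
    simp [Nat.choose_succ_succ]
  · have h0 : trinomial n ((a + 1 : ℕ) : ℤ) (((0 : ℕ) : ℤ) - 1) = 0 :=
      trinomial_of_neg_right _ _ (by simp)
    have e : ((a + 1 : ℕ) : ℤ) - 1 = (a : ℕ) := by push_cast; ring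
    rw [h0, e, trinomial_natCast, trinomial_natCast, trinomial_natCast]
    simp [Nat.choose_succ_succ]
  · have ea : ((a + 1 : ℕ) : ℤ) - 1 = (a : ℕ) := by push_cast; ring
    have eb : ((b + 1 : ℕ) : ℤ) - 1 = (b : ℕ) := by push_cast; ring
    rw [ea, eb, trinomial_natCast, trinomial_natCast, trinomial_natCast, trinomial_natCast]
    have e1 : a + 1 + (b + 1) = (a + b + 1) + 1 := by ring
    have e2 : a + (b + 1) = a + b + 1 := by ring
    have e3 : a + 1 + b = a + b + 1 := by ring
    rw [e1, e2, e3, Nat.choose_succ_succ n, Nat.choose_succ_succ (a + b + 1) a]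
    ring

/-- The sum over `r` of the trinomial coefficients of `n` with lower entries `r` and `r + l`, that
is, the number of three-step walks with `n` steps that rise by `l`. -/
def walkCount (n : ℕ) (l : ℤ) : ℕ := ∑ r ∈ Finset.range (n + 1), trinomial n r (r + l)

theorem walkCount_eq_sum_range {n N : ℕ} (h : n < N) (l : ℤ) :
    walkCount n l = ∑ r ∈ Finset.range N, trinomial n r (r + l) := by
  refine Finset.sum_subset (Finset.range_mono h) fun r _ hr => trinomial_of_lt _ ?_
  simp at hr
  omega

theorem walkCount_succ (n : ℕ) (l : ℤ) :
    walkCount (n + 1) l = walkCount n (l - 1) + walkCount n l + walkCount n (l + 1) := by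
  have h : ∑ r ∈ Finset.range (n + 2), trinomial n ((r : ℤ) - 1) (r + l) =
      walkCount n (l + 1) := by
    rw [Finset.sum_range_succ', Nat.cast_zero, trinomial_of_neg_left _ _ (by norm_num), add_zero]
    refine Finset.sum_congr rfl fun r _ => ?_
    congr 1 <;> push_cast <;> ring
  rw [← h, walkCount_eq_sum_range (show n < n + 2 by omega),
    walkCount_eq_sum_range (show n < n + 2 by omega), walkCount]
  simp only [trinomial_succ, Finset.sum_add_distrib, ← add_sub_assoc]
  ring

theorem trinomialSum_eq_sum_walkCount (n k : ℕ) :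
    trinomialSum n k = ∑ l ∈ Finset.Icc (-(k : ℤ)) (k + 1), walkCount n l := by
  unfold walkCount trinomialSum
  rw [Finset.sum_comm]
  refine finsum_eq_sum_of_support_subset _ fun r hr => ?_
  by_contra h
  refine hr (Finset.sum_eq_zero fun l _ => trinomial_of_lt _ ?_)
  simp at h
  omega

theorem walkCount_zero (l : ℤ) : walkCount 0 l = if l = 0 then 1 else 0 := by
  simp only [walkCount, zero_add, Finset.sum_range_one, Nat.cast_zero]
  split_ifs with h
  · simp [h, trinomial]
  · exact if_neg (by simp; omega)

/-- The two shifted windows together cover each integer as often as the shrunken and the enlarged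
window do, so sums over windows growing at both ends obey the recurrence of `pathCount_succ`. -/
theorem sum_walkCount_succ (n : ℕ) {a b : ℤ} (h : a + 2 ≤ b) :
    ∑ l ∈ Finset.Ico a b, walkCount (n + 1) l =
      ∑ l ∈ Finset.Ico (a + 1) (b - 1), walkCount n l + ∑ l ∈ Finset.Ico a b, walkCount n l +
      ∑ l ∈ Finset.Ico (a - 1) (b + 1), walkCount n l := by
  have consec : ∀ x y z : ℤ, x ≤ y → y ≤ z → ∑ l ∈ Finset.Ico x z, walkCount n l =
      ∑ l ∈ Finset.Ico x y, walkCount n l + ∑ l ∈ Finset.Ico y z, walkCount n l := by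
    intro x y z hxy hyz
    rw [← Finset.Ico_union_Ico_eq_Ico hxy hyz,
      Finset.sum_union (Finset.Ico_disjoint_Ico_consecutive x y z)]
  have e1 := Finset.sum_Ico_add' (walkCount n) a b (-1)
  have e2 := Finset.sum_Ico_add' (walkCount n) a b 1
  simp only [← sub_eq_add_neg] at e1
  simp only [walkCount_succ, Finset.sum_add_distrib, e1, e2]
  rw [consec (a + 1) (b - 1) (b + 1) (by omega) (by omega),
    consec (a - 1) (b - 1) (b + 1) (by omega) (by omega)]
  ring

/-- This is the reflection principle, summed over end points. Both sides obey the same recurrence;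
height `-1`, where the window is empty, supplies the boundary condition. -/
theorem pathCount_eq_sum_walkCount (n : ℕ) {h : ℤ} (hh : -1 ≤ h) :
    pathCount n h = ∑ l ∈ Finset.Ico (-h) (h + 2), walkCount n l := by
  induction n generalizing h with
  | zero =>
    rcases hh.eq_or_lt with rfl | hh
    · rw [pathCount_of_neg _ (by norm_num)]
      simp
    · rw [pathCount_zero (by omega)]
      simp only [walkCount_zero, Finset.sum_ite_eq', Finset.mem_Ico]
      rw [if_pos (by omega)]
  | succ n ih =>
    rcases hh.eq_or_lt with rfl | hh
    · rw [pathCount_of_neg _ (by norm_num)]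
      simp
    · rw [pathCount_succ n (by omega), sum_walkCount_succ n (by omega), ih (by omega),
        ih (by omega), ih (by omega), show -(h - 1) = -h + 1 by ring,
        show h - 1 + 2 = h + 2 - 1 by ring, show -(h + 1) = -h - 1 by ring,
        show h + 1 + 2 = h + 2 + 1 by ring]

theorem motzkinPrefix_eq_trinomialSum (n k : ℕ) : motzkinPrefix n k = trinomialSum n k := by
  rw [motzkinPrefix_eq_pathCount, pathCount_eq_sum_walkCount n (by omega),
    trinomialSum_eq_sum_walkCount]
  refine Finset.sum_congr (Finset.ext fun l => ?_) fun _ _ => rfl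
  simp only [Finset.mem_Ico, Finset.mem_Icc]
  omega

/-! ### Hankel determinants of a functional multiplied by a polynomial. -/

open Polynomial in
/-- Hankel determinants of a functional with monic orthogonal polynomials of norm one. -/
theorem det_hankel_eq_one (L : ℤ[X] →ₗ[ℤ] ℤ) (V : ℕ → ℤ[X]) (monic : ∀ n, (V n).Monic)
    (deg : ∀ n, (V n).natDegree = n) (orth : ∀ n j, j < n → L (V n * X ^ j) = 0)
    (norm : ∀ n, L (V n * X ^ n) = 1) (N : ℕ) :
    (Matrix.of fun i j : Fin N => L (X ^ ((i : ℕ) + (j : ℕ)))).det = 1 := by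
  have h1 : (Matrix.of fun i j : Fin N => (V i).coeff j).det = 1 := by
    rw [← Matrix.det_transpose]
    exact Matrix.det_matrixOfPolynomials (fun i : Fin N => V i) (fun i => deg i) fun i => monic i
  have h2 : (Matrix.of fun i j : Fin N => L (V i * X ^ (j : ℕ))).det = 1 := by
    refine (Matrix.det_of_isUpperTriangular fun (i j : Fin N) hij => orth i j hij).trans ?_
    simp [norm]
  have h3 : (Matrix.of fun i j : Fin N => L (V i * X ^ (j : ℕ))) =
      (Matrix.of fun i j : Fin N => (V i).coeff j) *
        (Matrix.of fun i j : Fin N => L (X ^ ((i : ℕ) + (j : ℕ)))) := by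
    ext i j
    simp only [Matrix.mul_apply, Matrix.of_apply]
    conv_lhs => rw [(V i).as_sum_range' N (by rw [deg]; exact i.2)]
    simp only [Finset.sum_mul, map_sum, Finset.sum_range, ← smul_X_eq_monomial, smul_mul_assoc,
      ← pow_add, map_smul, smul_eq_mul]
  rw [h3, Matrix.det_mul, h1, one_mul] at h2
  exact h2

theorem finRotate_pow_val (N k : ℕ) (b : Fin N) : ((finRotate N ^ k) b : ℕ) = (b + k) % N := by
  induction k with
  | zero => simp [Nat.mod_eq_of_lt b.2]
  | succ k ih =>
    rw [pow_succ', Equiv.Perm.mul_apply]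
    obtain ⟨N, rfl⟩ : ∃ M, N = M + 1 := ⟨N - 1, by have := b.2; omega⟩
    rw [finRotate_apply, Fin.val_add, ih, Fin.val_one', ← Nat.add_mod, add_assoc]

/-- The exponent `(n + d - 1) * d` differs from `n * d` by the even number `d * (d - 1)`. -/
theorem sign_finRotate_pow (n d : ℕ) :
    ((Equiv.Perm.sign (finRotate (n + d) ^ d) : ℤˣ) : ℤ) = (-1) ^ (n * d) := by
  rw [map_pow, sign_finRotate]
  rcases d with _ | m
  · simp
  · have e : (n + (m + 1) - 1) * (m + 1) = m * (m + 1) + n * (m + 1) := by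
      rw [show n + (m + 1) - 1 = n + m by omega]
      ring
    push_cast
    rw [← pow_mul, e, pow_add, (Nat.even_mul_succ_self m).neg_one_pow, one_mul]

open Polynomial in
/-- The coefficients of the multiples `q, qX, …, qX^(n-1)` of a monic polynomial `q` of degree `d`
and of monic polynomials of degrees `0, …, d-1`. -/
theorem det_coeff_multiples (V : ℕ → ℤ[X]) (monic : ∀ n, (V n).Monic)
    (deg : ∀ n, (V n).natDegree = n) (q : ℤ[X]) (hq : q.Monic) (n d : ℕ) (hd : q.natDegree = d) :
    (Matrix.of fun a b : Fin n ⊕ Fin d =>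
      (Sum.elim (fun j : Fin n => q * X ^ (j : ℕ)) (fun i : Fin d => V i) a).coeff
        (finSumFinEquiv b : Fin (n + d))).det = (-1) ^ (n * d) := by
  set p : Fin n ⊕ Fin d → ℤ[X] :=
    Sum.elim (fun j : Fin n => q * X ^ (j : ℕ)) (fun i : Fin d => V i) with hp
  set e : Fin n ⊕ Fin d ≃ Fin (n + d) := finSumFinEquiv
  -- The rows have degrees `d, …, d+n-1, 0, …, d-1`; rotating by `d` puts each row at the position
  -- of its degree, where the matrix is unitriangular.
  set e' : Fin n ⊕ Fin d ≃ Fin (n + d) := e.trans (finRotate (n + d) ^ d) with he'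
  have ve' : ∀ a, (e' a : ℕ) = (Sum.elim (fun j : Fin n => d + j) (fun i : Fin d => i) a : ℕ) := by
    intro a
    rw [he', Equiv.trans_apply, finRotate_pow_val]
    rcases a with j | i
    · simp only [e, finSumFinEquiv_apply_left, Fin.val_castAdd, Sum.elim_inl]
      rw [Nat.mod_eq_of_lt (by omega), add_comm]
    · simp only [e, finSumFinEquiv_apply_right, Fin.val_natAdd, Sum.elim_inr]
      rw [show n + (i : ℕ) + d = i + (n + d) by ring, Nat.add_mod_right,
        Nat.mod_eq_of_lt (by omega)]
  have hdeg : ∀ a, (p a).natDegree = e' a := by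
    rintro (j | i)
    · rw [ve', hp, Sum.elim_inl, Sum.elim_inl, hq.natDegree_mul (monic_X_pow _), natDegree_X_pow, hd]
    · rw [ve', hp, Sum.elim_inr, Sum.elim_inr, deg]
  have hmon : ∀ a, (p a).Monic := by
    rintro (j | i)
    · exact hq.mul (monic_X_pow _)
    · exact monic _
  have h1 : (Matrix.of fun i j : Fin (n + d) => (p (e'.symm i)).coeff j).det = 1 := by
    rw [← Matrix.det_transpose]
    exact Matrix.det_matrixOfPolynomials (fun i => p (e'.symm i)) (fun i => by simp [hdeg])
      fun i => hmon _
  have h2 := Matrix.det_permute' (finRotate (n + d) ^ d)⁻¹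
    (Matrix.of fun i j : Fin (n + d) => (p (e'.symm i)).coeff j)
  rw [h1, mul_one, Equiv.Perm.sign_inv, sign_finRotate_pow, ← Matrix.det_submatrix_equiv_self e'] at h2
  refine Eq.trans (congrArg Matrix.det ?_) (h2.trans (by push_cast; rfl))
  ext a b
  simp [he']

open Polynomial in
/-- The Hankel determinant of a functional multiplied by a monic polynomial `q`, in terms of the
residues modulo `q` of the orthogonal polynomials. -/
theorem det_hankel_mul (L : ℤ[X] →ₗ[ℤ] ℤ) (V : ℕ → ℤ[X]) (monic : ∀ n, (V n).Monic)
    (deg : ∀ n, (V n).natDegree = n) (orth : ∀ n j, j < n → L (V n * X ^ j) = 0)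
    (norm : ∀ n, L (V n * X ^ n) = 1) (q : ℤ[X]) (hq : q.Monic) (n d : ℕ) (hd : q.natDegree = d)
    (R : Matrix (Fin d) (Fin d) ℤ)
    (hR : ∀ i : Fin d, q ∣ V (n + i) - ∑ j : Fin d, R i j • V j) :
    (Matrix.of fun i j : Fin n => L (q * X ^ ((i : ℕ) + (j : ℕ)))).det =
      (-1) ^ (n * d) * R.det := by
  choose Q hQ using hR
  have hV : ∀ i : Fin d, V (n + i) = q * Q i + ∑ j : Fin d, R i j • V j := fun i => by
    rw [← hQ, sub_add_cancel]
  have hsum : ∀ i : Fin d, (∑ j : Fin d, R i j • V j).degree < ((n + d : ℕ) : WithBot ℕ) := by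
    intro i
    refine (degree_sum_le _ _).trans_lt ((Finset.sup_lt_iff (WithBot.bot_lt_coe _)).2 fun j _ => ?_)
    refine (degree_smul_le _ _).trans_lt ?_
    rw [degree_eq_natDegree (monic j).ne_zero, deg]
    exact_mod_cast (by omega : (j : ℕ) < n + d)
  -- This bound makes `q * Q i` a combination of the rows `q, qX, …, qX^(n-1)` alone.
  have hQdeg : ∀ i, (Q i).degree < (n : WithBot ℕ) := by
    intro i
    have h1 : (q * Q i).degree < ((n + d : ℕ) : WithBot ℕ) := by
      rw [← hQ]
      refine (degree_sub_le _ _).trans_lt (max_lt ?_ (hsum i))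
      rw [degree_eq_natDegree (monic _).ne_zero, deg]
      exact_mod_cast (by omega : n + (i : ℕ) < n + d)
    by_cases h0 : Q i = 0
    · rw [h0, degree_zero]
      exact WithBot.bot_lt_coe _
    rw [degree_mul, degree_eq_natDegree hq.ne_zero, degree_eq_natDegree h0, hd] at h1
    rw [degree_eq_natDegree h0]
    have h2 : d + (Q i).natDegree < n + d := by exact_mod_cast h1
    exact_mod_cast (by omega : (Q i).natDegree < n)
  have hQsum : ∀ i, Q i = ∑ j : Fin n, (Q i).coeff j • X ^ (j : ℕ) := by
    intro i
    conv_lhs => rw [← sum_C_mul_X_pow_eq (Q i), ← sum_fin _ (by simp) (hQdeg i)]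
    simp only [smul_eq_C_mul]
  set e : Fin n ⊕ Fin d ≃ Fin (n + d) := finSumFinEquiv
  set p : Fin n ⊕ Fin d → ℤ[X] :=
    Sum.elim (fun j : Fin n => q * X ^ (j : ℕ)) (fun i : Fin d => V (n + i)) with hp
  set p' : Fin n ⊕ Fin d → ℤ[X] :=
    Sum.elim (fun j : Fin n => q * X ^ (j : ℕ)) (fun i : Fin d => V i) with hp'
  have hpdeg : ∀ a, (p a).natDegree < n + d := by
    rintro (j | i)
    · rw [hp, Sum.elim_inl, hq.natDegree_mul (monic_X_pow _), natDegree_X_pow, hd]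
      omega
    · rw [hp, Sum.elim_inr, deg]
      omega
  have hG : (Matrix.of fun a b : Fin n ⊕ Fin d => (p a).coeff (e b)) =
      Matrix.fromBlocks 1 0 (Matrix.of fun (i : Fin d) (j : Fin n) => (Q i).coeff j) R *
        Matrix.of fun a b : Fin n ⊕ Fin d => (p' a).coeff (e b) := by
    ext a b
    rw [Matrix.mul_apply, Fintype.sum_sum_type]
    rcases a with a | i
    · simp [Matrix.one_apply, hp, hp']
    · simp only [Matrix.of_apply, Matrix.fromBlocks_apply₂₁, Matrix.fromBlocks_apply₂₂, hp, hp',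
        Sum.elim_inl, Sum.elim_inr]
      rw [hV, coeff_add]
      conv_lhs => rw [hQsum]
      simp only [Finset.mul_sum, mul_smul_comm, finsetSum_coeff, coeff_smul, smul_eq_mul]
  have hH : (Matrix.of fun a b : Fin n ⊕ Fin d => L (p a * X ^ (e b : ℕ))) =
      (Matrix.of fun a b : Fin n ⊕ Fin d => (p a).coeff (e b)) *
        Matrix.of fun a b : Fin n ⊕ Fin d => L (X ^ ((e a : ℕ) + (e b : ℕ))) := by
    ext a b
    simp only [Matrix.mul_apply, Matrix.of_apply]
    rw [e.sum_comp fun x => (p a).coeff x * L (X ^ ((x : ℕ) + (e b : ℕ)))]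
    conv_lhs => rw [(p a).as_sum_range' (n + d) (hpdeg a)]
    simp only [Finset.sum_mul, map_sum, Finset.sum_range, ← smul_X_eq_monomial, smul_mul_assoc,
      ← pow_add, map_smul, smul_eq_mul]
  have hH1 : (Matrix.of fun a b : Fin n ⊕ Fin d => L (X ^ ((e a : ℕ) + (e b : ℕ)))).det = 1 := by
    rw [← det_hankel_eq_one L V monic deg orth norm (n + d), ← Matrix.det_submatrix_equiv_self e]
    rfl
  -- Orthogonality kills the lower left block and makes the lower right one unitriangular, so this
  -- determinant is the wanted one; `hG` and `hH` compute it a second time.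
  have hblocks : (Matrix.of fun a b : Fin n ⊕ Fin d => L (p a * X ^ (e b : ℕ))) =
      Matrix.fromBlocks (Matrix.of fun i j : Fin n => L (q * X ^ ((i : ℕ) + (j : ℕ))))
        (Matrix.of fun (i : Fin n) (j : Fin d) => L (q * X ^ (i : ℕ) * X ^ (n + (j : ℕ)))) 0
        (Matrix.of fun i j : Fin d => L (V (n + i) * X ^ (n + (j : ℕ)))) := by
    ext a b
    rcases a with a | a <;> rcases b with b | b
    · simp [hp, e, mul_assoc, pow_add]
    · simp [hp, e]
    · simp [hp, e, orth (n + a) b (by omega)]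
    · simp [hp, e]
  have htri : (Matrix.of fun i j : Fin d => L (V (n + i) * X ^ (n + (j : ℕ)))).det = 1 := by
    refine (Matrix.det_of_isUpperTriangular fun (i j : Fin d) hij =>
      orth (n + i) (n + j) (Nat.add_lt_add_left hij n)).trans ?_
    simp [norm]
  have h1 := congrArg Matrix.det hH
  rw [hblocks, Matrix.det_fromBlocks_zero₂₁, htri, mul_one, Matrix.det_mul, hH1, mul_one, hG,
    Matrix.det_mul, Matrix.det_fromBlocks_zero₁₂, Matrix.det_one, one_mul,
    det_coeff_multiples V monic deg q hq n d hd] at h1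
  rw [h1, mul_comm]

/-! ### Shifted Chebyshev polynomials and their residues. -/

open Polynomial in
/-- The polynomials `S_n(x - 1)`, for the rescaled Chebyshev polynomials `S_n` of the second
kind. -/
noncomputable def shiftedS (n : ℤ) : ℤ[X] := (Chebyshev.S ℤ n).comp (X - 1)

open Polynomial in
/-- The polynomials `C_n(x - 1)`, for the rescaled Chebyshev polynomials `C_n` of the first
kind. -/
noncomputable def shiftedC (n : ℤ) : ℤ[X] := (Chebyshev.C ℤ n).comp (X - 1)

/-- Shifted and rescaled Chebyshev polynomials of the third kind. -/
noncomputable def shiftedV (n : ℤ) : Polynomial ℤ := shiftedS n - shiftedS (n - 1)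

section
open Polynomial

theorem shiftedS_zero : shiftedS 0 = 1 := by simp [shiftedS]

theorem shiftedS_neg_one : shiftedS (-1) = 0 := by simp [shiftedS]

theorem shiftedS_add_one (n : ℤ) : shiftedS (n + 1) = (X - 1) * shiftedS n - shiftedS (n - 1) := by
  simp [shiftedS, Chebyshev.S_add_one]

theorem shiftedS_neg_sub_two (n : ℤ) : shiftedS (-n - 2) = -shiftedS n := by
  simp [shiftedS, Chebyshev.S_neg_sub_two]

theorem shiftedC_zero : shiftedC 0 = 2 := by simp [shiftedC]

theorem shiftedC_one : shiftedC 1 = X - 1 := by simp [shiftedC]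

theorem shiftedC_add_one (n : ℤ) : shiftedC (n + 1) = (X - 1) * shiftedC n - shiftedC (n - 1) := by
  simp [shiftedC, Chebyshev.C_add_one]

theorem shiftedV_zero : shiftedV 0 = 1 := by simp [shiftedV, shiftedS_zero, shiftedS_neg_one]

theorem shiftedV_add_one (n : ℤ) : shiftedV (n + 1) = (X - 1) * shiftedV n - shiftedV (n - 1) := by
  have := shiftedS_add_one (n - 1)
  rw [sub_add_cancel] at this
  rw [shiftedV, shiftedV, shiftedV, shiftedS_add_one, add_sub_cancel_right, this]
  ring

theorem shiftedV_neg (n : ℤ) : shiftedV (-1 - n) = shiftedV n := by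
  have h1 := shiftedS_neg_sub_two (n - 1)
  have h2 := shiftedS_neg_sub_two n
  rw [shiftedV, shiftedV, show -1 - n = -(n - 1) - 2 by ring, h1,
    show -(n - 1) - 2 - 1 = -n - 2 by ring, h2]
  ring

/-- In the basis of the `shiftedV i` with `i < d`, the polynomial `shiftedS (d - 1)` is the all-ones
vector; hence the corrections to the folding have rank one. -/
theorem sum_shiftedV (d : ℕ) : ∑ i ∈ Finset.range d, shiftedV i = shiftedS (d - 1) := by
  induction d with
  | zero => simp [shiftedS_neg_one]
  | succ d ih =>
    rw [Finset.sum_range_succ, ih, shiftedV]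
    simp

theorem shiftedV_natDegree_and_monic (n : ℕ) : (shiftedV n).natDegree = n ∧ (shiftedV n).Monic := by
  have hX : (X - 1 : ℤ[X]).Monic := by simpa using monic_X_sub_C (1 : ℤ)
  have hX1 : (X - 1 : ℤ[X]).natDegree = 1 := by simpa using natDegree_X_sub_C (1 : ℤ)
  induction n using Nat.strong_induction_on with
  | _ n ih =>
    rcases n with _ | _ | n
    · simp [shiftedV_zero]
    · have h : shiftedV ((0 + 1 : ℕ) : ℤ) = X - C 2 := by
        have := shiftedV_neg 0
        rw [sub_zero] at this
        rw [Nat.cast_succ, Nat.cast_zero, shiftedV_add_one, zero_sub, this, shiftedV_zero,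
          map_ofNat]
        ring
      rw [h]
      exact ⟨natDegree_X_sub_C _, monic_X_sub_C _⟩
    · obtain ⟨h1, m1⟩ := ih (n + 1) (by omega)
      obtain ⟨h0, -⟩ := ih n (by omega)
      have h : shiftedV ((n + 1 + 1 : ℕ) : ℤ) =
          (X - 1) * shiftedV ((n + 1 : ℕ) : ℤ) - shiftedV (n : ℕ) := by
        rw [Nat.cast_succ, shiftedV_add_one]
        simp
      have hm : ((X - 1) * shiftedV ((n + 1 : ℕ) : ℤ)).Monic := hX.mul m1
      have hd : ((X - 1) * shiftedV ((n + 1 : ℕ) : ℤ)).natDegree = n + 2 := by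
        rw [hX.natDegree_mul m1, hX1, h1]
        ring
      have hlt : (shiftedV (n : ℕ)).natDegree < ((X - 1) * shiftedV ((n + 1 : ℕ) : ℤ)).natDegree := by
        omega
      rw [h]
      refine ⟨?_, hm.sub_of_left (degree_lt_degree hlt)⟩
      rw [natDegree_sub_eq_left_of_natDegree_lt hlt, hd]

theorem shiftedS_natDegree_and_monic (n : ℕ) : (shiftedS n).natDegree = n ∧ (shiftedS n).Monic := by
  induction n with
  | zero => simp [shiftedS_zero]
  | succ n ih =>
    have h : shiftedS ((n + 1 : ℕ) : ℤ) = shiftedV ((n + 1 : ℕ) : ℤ) + shiftedS n := by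
      simp [shiftedV]
    obtain ⟨hd, hm⟩ := shiftedV_natDegree_and_monic (n + 1)
    have hlt : (shiftedS n).natDegree < (shiftedV ((n + 1 : ℕ) : ℤ)).natDegree := by omega
    rw [h]
    exact ⟨by rw [natDegree_add_eq_left_of_natDegree_lt hlt, hd],
      hm.add_of_left (degree_lt_degree hlt)⟩

/-- With `x - 1 = 2 cos θ` this is `sin ((m+n)θ) - sin ((m-n)θ) = 2 sin (nθ) cos (mθ)` divided by
`sin θ`. -/
theorem shiftedS_add_sub (m : ℕ) (n : ℤ) :
    shiftedS (m - 1 + n) - shiftedS (m - 1 - n) = shiftedS (n - 1) * shiftedC m := by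
  have key : ∀ m : ℕ,
      shiftedS (m - 1 + n) - shiftedS (m - 1 - n) = shiftedS (n - 1) * shiftedC m ∧
      shiftedS (m + n) - shiftedS (m - n) = shiftedS (n - 1) * shiftedC (m + 1) := by
    intro m
    induction m with
    | zero =>
      have h1 := shiftedS_neg_sub_two (n - 2)
      have h2 := shiftedS_add_one (n - 1)
      have h3 := shiftedS_neg_sub_two (n - 1)
      rw [sub_add_cancel, sub_sub, one_add_one_eq_two] at h2
      rw [show -(n - 2) - 2 = -n by ring] at h1
      rw [show -(n - 1) - 2 = -1 - n by ring] at h3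
      simp only [Nat.cast_zero, zero_add, zero_sub, shiftedC_one, shiftedC_zero, h1, h2, h3,
        show -1 + n = n - 1 by ring]
      constructor <;> ring
    | succ m ih =>
      rw [Nat.cast_succ, add_sub_cancel_right]
      refine ⟨ih.2, ?_⟩
      have h1 := shiftedS_add_one (m + n)
      have h2 := shiftedS_add_one (m - n)
      rw [show (m : ℤ) + n + 1 = m + 1 + n by ring, show (m : ℤ) + n - 1 = m - 1 + n by ring] at h1
      rw [show (m : ℤ) - n + 1 = m + 1 - n by ring, show (m : ℤ) - n - 1 = m - 1 - n by ring] at h2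
      rw [shiftedC_add_one, add_sub_cancel_right, h1, h2]
      linear_combination (X - 1) * ih.2 - ih.1
  exact (key m).1

theorem shiftedV_add_sub (m : ℕ) (n : ℤ) :
    shiftedV (m + n) - shiftedV (m - n) =
      shiftedS (n - 1) * (shiftedC (m + 1 : ℕ) - shiftedC m) := by
  have h1 := shiftedS_add_sub (m + 1) n
  have h2 := shiftedS_add_sub m n
  rw [Nat.cast_succ, add_sub_cancel_right] at h1
  rw [Nat.cast_succ, mul_sub, ← h1, ← h2, shiftedV, shiftedV,
    show (m : ℤ) + n - 1 = m - 1 + n by ring, show (m : ℤ) - n - 1 = m - 1 - n by ring]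
  ring

/-- The values `2 cos (2 π n / 3)`. -/
def cubicTrace (n : ℕ) : ℤ := if n % 3 = 0 then 2 else -1

theorem eval_zero_shiftedC (n : ℕ) : (shiftedC n).eval 0 = cubicTrace n := by
  have key : ∀ n : ℕ, (shiftedC n).eval 0 = cubicTrace n ∧
      (shiftedC ((n : ℤ) + 1)).eval 0 = cubicTrace (n + 1) := by
    intro n
    induction n with
    | zero => simp [shiftedC_zero, shiftedC_one, cubicTrace]
    | succ n ih =>
      refine ⟨by simpa using ih.2, ?_⟩
      rw [shiftedC_add_one, eval_sub, eval_mul, Nat.cast_succ, add_sub_cancel_right, ih.1, ih.2]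
      simp only [eval_sub, eval_X, eval_one, cubicTrace]
      split_ifs <;> omega
  exact (key n).1

/-- Translation by `2d` of the index of `shiftedV`, modulo `X * shiftedS (d - 1)`. -/
theorem dvd_shiftedV_add_sub (m d : ℕ) :
    X * shiftedS (d - 1) ∣ shiftedV (m + d : ℕ) -
      (shiftedV ((m : ℤ) - d) + (cubicTrace (m + 1) - cubicTrace m) • shiftedS (d - 1)) := by
  -- Since the modulus contains the factor `X`, the cofactor of `shiftedS (d - 1)` matters only
  -- through its value at 0.
  have h : X ∣ shiftedC (m + 1 : ℕ) - shiftedC m - C (cubicTrace (m + 1) - cubicTrace m) := by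
    rw [X_dvd_iff, coeff_zero_eq_eval_zero]
    simp only [eval_sub, eval_zero_shiftedC, eval_C, sub_self]
  obtain ⟨w, hw⟩ := h
  refine ⟨w, ?_⟩
  have h1 := shiftedV_add_sub m d
  rw [Nat.cast_add, smul_eq_C_mul]
  linear_combination h1 + shiftedS (d - 1) * hw

/-- The coefficient of `shiftedS (d - 1)` in `shiftedV (q * d + r)` modulo
`X * shiftedS (d - 1)`. -/
def residueCoeff (d : ℕ) : ℕ → ℕ → ℤ
  | 0, _ => 0
  | 1, r => cubicTrace (r + 1) - cubicTrace r
  | q + 2, r => residueCoeff d q r +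
      (cubicTrace ((q + 1) * d + r + 1) - cubicTrace ((q + 1) * d + r))

/-- Translation by `2d` lowers `q` by two. For `q = 1` it gives the negative index `r - d`, which
`shiftedV_neg` reflects to `d - 1 - r`. -/
theorem dvd_shiftedV (d q r : ℕ) (hr : r < d) :
    X * shiftedS (d - 1) ∣ shiftedV (q * d + r : ℕ) -
      (shiftedV ((if Even q then r else d - 1 - r : ℕ)) +
        residueCoeff d q r • shiftedS (d - 1)) := by
  have key : ∀ q : ℕ, (X * shiftedS (d - 1) ∣ shiftedV (q * d + r : ℕ) -
      (shiftedV ((if Even q then r else d - 1 - r : ℕ)) +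
        residueCoeff d q r • shiftedS (d - 1))) ∧
      (X * shiftedS (d - 1) ∣ shiftedV ((q + 1) * d + r : ℕ) -
      (shiftedV ((if Even (q + 1) then r else d - 1 - r : ℕ)) +
        residueCoeff d (q + 1) r • shiftedS (d - 1))) := by
    intro q
    induction q with
    | zero =>
      refine ⟨by simp [residueCoeff], ?_⟩
      have h := dvd_shiftedV_add_sub r d
      rw [← shiftedV_neg ((r : ℤ) - d), show -1 - ((r : ℤ) - d) = ((d - 1 - r : ℕ) : ℤ) by omega] at h
      rw [zero_add, one_mul, add_comm d, if_neg (by simp), residueCoeff]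
      exact h
    | succ q ih =>
      refine ⟨ih.2, ?_⟩
      have h := dvd_shiftedV_add_sub ((q + 1) * d + r) d
      rw [show (((q + 1) * d + r : ℕ) : ℤ) - d = (q * d + r : ℕ) by push_cast; ring,
        show (q + 1) * d + r + d = (q + 1 + 1) * d + r by ring] at h
      have e : Even (q + 1 + 1) ↔ Even q := by simp [Nat.even_add_one]
      simp only [e, residueCoeff]
      convert dvd_add h ih.1 using 1
      rw [add_smul]
      ring
  exact (key q).1

end

/-! ### Determinants of 0/1 matrices plus a rank-one matrix. -/

theorem Matrix.det_of_row_eq_add_smul {ι : Type*} [Fintype ι] [DecidableEq ι] (M : Matrix ι ι ℤ)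
    {i₀ i₁ : ι} (h : i₀ ≠ i₁) (c : ℤ) (v : ι → ℤ) (hM : M i₀ = M i₁ + c • v) :
    M.det = c * (M.updateRow i₀ v).det := by
  have h1 : M.det = (M.updateRow i₀ (M i₁ + c • v)).det := by
    rw [← hM, Matrix.updateRow_eq_self]
  rw [h1, Matrix.det_updateRow_add, Matrix.det_updateRow_smul, Matrix.det_updateRow_eq_zero h.symm,
    zero_add]

/-- The matrix with a `1` in row `i` and column `σ i`, plus `a i` in all of row `i`. -/
def rankOneShift {ι : Type*} [DecidableEq ι] (σ : ι → ι) (a : ι → ℤ) : Matrix ι ι ℤ :=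
  Matrix.of fun i j => (if σ i = j then 1 else 0) + a i

theorem rankOneShift_row_eq {ι : Type*} [DecidableEq ι] (σ : ι → ι) (a : ι → ℤ) {i₀ i₁ : ι}
    (hσ : σ i₀ = σ i₁) :
    rankOneShift σ a i₀ = rankOneShift σ a i₁ + (a i₀ - a i₁) • fun _ => 1 := by
  ext j
  simp [rankOneShift, hσ]

theorem det_rankOneShift_perm {ι : Type*} [Fintype ι] [DecidableEq ι] (π : Equiv.Perm ι)
    (a : ι → ℤ) : (rankOneShift π a).det = Equiv.Perm.sign π * (1 + ∑ i, a i) := by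
  have h : rankOneShift π a =
      (1 + Matrix.replicateCol Unit (fun i => a (π.symm i)) *
        Matrix.replicateRow Unit (fun _ : ι => (1 : ℤ))).submatrix π id := by
    ext i j
    simp [rankOneShift, Matrix.mul_apply, Matrix.one_apply]
  rw [h, Matrix.det_permute, Matrix.det_one_add_replicateCol_mul_replicateRow]
  simp [dotProduct, Equiv.sum_comp π.symm a]

theorem det_rankOneShift_of_repeat {ι : Type*} [Fintype ι] [DecidableEq ι] (π : Equiv.Perm ι)
    (σ : ι → ι) (a : ι → ℤ) {i₀ i₁ : ι} (h : i₀ ≠ i₁) (h₀ : σ i₀ = π i₁)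
    (hσ : ∀ i, i ≠ i₀ → σ i = π i) :
    (rankOneShift σ a).det = Equiv.Perm.sign π * (a i₀ - a i₁) := by
  rw [Matrix.det_of_row_eq_add_smul _ h _ _
    (rankOneShift_row_eq σ a (h₀.trans (hσ i₁ h.symm).symm))]
  have e1 : (rankOneShift σ a).updateRow i₀ (fun _ => 1) =
      (rankOneShift π a).updateRow i₀ (fun _ => 1) := by
    ext i j
    by_cases hi : i = i₀
    · simp [hi]
    · simp [Matrix.updateRow_ne hi, rankOneShift, hσ i hi]
  -- Raising `a i₀` by 1 adds the all-ones row to row `i₀`. So the determinant with that row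
  -- replaced by ones is a difference of two values of `det_rankOneShift_perm`, namely the sign of
  -- `π`.
  have e2 : rankOneShift π (Function.update a i₀ (a i₀ + 1)) =
      (rankOneShift π a).updateRow i₀ (rankOneShift π a i₀ + fun _ => 1) := by
    ext i j
    by_cases hi : i = i₀
    · subst hi
      simp [rankOneShift, add_assoc]
    · simp [rankOneShift, hi]
  have e3 := congrArg Matrix.det e2
  rw [Matrix.det_updateRow_add, Matrix.updateRow_eq_self, det_rankOneShift_perm,
    det_rankOneShift_perm, Finset.sum_update_of_mem (Finset.mem_univ _),
    ← Finset.add_sum_erase _ a (Finset.mem_univ i₀), Finset.sdiff_singleton_eq_erase] at e3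
  rw [e1]
  linear_combination -(a i₀ - a i₁) * e3

/-- Each repetition lets a row be replaced by a multiple of the all-ones row, and two such rows are
proportional. -/
theorem det_rankOneShift_eq_zero {ι : Type*} [Fintype ι] [DecidableEq ι] (σ : ι → ι) (a : ι → ℤ)
    {i₀ i₁ i₂ i₃ : ι} (h₀₁ : i₀ ≠ i₁) (h₂₃ : i₂ ≠ i₃) (h₀₂ : i₀ ≠ i₂) (h₀₃ : i₀ ≠ i₃)
    (hσ₀₁ : σ i₀ = σ i₁) (hσ₂₃ : σ i₂ = σ i₃) : (rankOneShift σ a).det = 0 := by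
  rw [Matrix.det_of_row_eq_add_smul _ h₀₁ _ _ (rankOneShift_row_eq σ a hσ₀₁),
    Matrix.det_of_row_eq_add_smul _ h₂₃ (a i₂ - a i₃) (fun _ => 1),
    Matrix.det_zero_of_row_eq h₀₂, mul_zero, mul_zero]
  · ext j
    simp [Matrix.updateRow_ne h₀₂]
  · rw [Matrix.updateRow_ne h₀₂.symm, Matrix.updateRow_ne h₀₃.symm, rankOneShift_row_eq σ a hσ₂₃]

theorem sign_revPerm (n : ℕ) :
    Equiv.Perm.sign (Fin.revPerm : Equiv.Perm (Fin n)) = (-1) ^ n.choose 2 := by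
  induction n with
  | zero => simp [Subsingleton.elim (Fin.revPerm : Equiv.Perm (Fin 0)) 1]
  | succ n ih =>
    -- Reversal followed by rotation fixes 0 and reverses the rest.
    have h : Equiv.Perm.decomposeFin.symm (0, (Fin.revPerm : Equiv.Perm (Fin n))) =
        finRotate (n + 1) * Fin.revPerm := by
      ext i
      refine Fin.cases ?_ (fun i => ?_) i
      · simp
      · simp [Fin.rev_succ]
    have h1 := congrArg Equiv.Perm.sign h
    rw [Equiv.Perm.decomposeFin.symm_sign, if_pos rfl, one_mul, ih, map_mul, sign_finRotate,
      Nat.succ_sub_one] at h1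
    rw [Nat.choose_succ_succ' n 1, Nat.choose_one_right, pow_add, h1, ← mul_assoc, ← mul_pow]
    simp

/-! ### The path functional and the reduction to a small determinant. -/

section
open Polynomial

/-- The functional on polynomials whose moments are the numbers of three-step paths starting at
height zero. -/
noncomputable def pathFunctional : ℤ[X] →ₗ[ℤ] ℤ :=
  (basisMonomials ℤ).constr ℤ fun m => (pathCount m 0 : ℤ)

theorem pathFunctional_X_pow (m : ℕ) : pathFunctional (X ^ m) = pathCount m 0 := by
  have h := (basisMonomials ℤ).constr_basis ℤ (fun m => (pathCount m 0 : ℤ)) m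
  rw [coe_basisMonomials] at h
  rw [← monomial_one_right_eq_X_pow]
  exact h

theorem pathFunctional_shiftedS_mul (k m : ℕ) :
    pathFunctional (shiftedS k * X ^ m) = pathCount m k := by
  have key : ∀ k : ℕ, (∀ m, pathFunctional (shiftedS ((k : ℤ) - 1) * X ^ m) =
      pathCount m ((k : ℤ) - 1)) ∧ ∀ m, pathFunctional (shiftedS k * X ^ m) = pathCount m k := by
    intro k
    induction k with
    | zero =>
      simp [shiftedS_zero, shiftedS_neg_one, pathFunctional_X_pow, pathCount_of_neg]
    | succ k ih =>
      rw [Nat.cast_succ, add_sub_cancel_right]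
      refine ⟨ih.2, fun m => ?_⟩
      have h : shiftedS ((k : ℤ) + 1) * X ^ m = shiftedS k * X ^ (m + 1) - shiftedS k * X ^ m -
          shiftedS ((k : ℤ) - 1) * X ^ m := by
        rw [shiftedS_add_one]
        ring
      rw [h, map_sub, map_sub, ih.1, ih.2, ih.2, pathCount_succ m (Int.natCast_nonneg k)]
      push_cast
      ring
  exact (key k).2 m

/-- Starting from height at least `m`, no path with `m` steps can become negative, so the count no
longer depends on the height. -/
theorem pathCount_sub_eq_zero (m : ℕ) {h : ℤ} (hm : m < h) :
    pathCount m h = pathCount m (h - 1) := by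
  induction m generalizing h with
  | zero => rw [pathCount_zero (by omega), pathCount_zero (by omega)]
  | succ m ih =>
    push_cast at hm
    rw [pathCount_succ m (by omega), pathCount_succ m (by omega), ih (by omega : (m : ℤ) < h),
      ih (by omega : (m : ℤ) < h + 1), ih (by omega : (m : ℤ) < h - 1), sub_add_cancel,
      add_sub_cancel_right, ih (by omega : (m : ℤ) < h)]

/-- The extra path corresponds to the one consisting of down-steps only, which fails from height `m
- 1`. -/
theorem pathCount_self (m : ℕ) : pathCount m m = pathCount m ((m : ℤ) - 1) + 1 := by
  induction m with
  | zero => rw [pathCount_zero (by simp), pathCount_of_neg _ (by norm_num)]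
  | succ m ih =>
    rw [pathCount_succ m (by omega), pathCount_succ m (by omega), Nat.cast_succ,
      add_sub_cancel_right, pathCount_sub_eq_zero m (h := (m : ℤ) + 1) (by omega),
      pathCount_sub_eq_zero m (h := (m : ℤ) + 1 + 1) (by omega), add_sub_cancel_right,
      show (m : ℤ) + 1 + 1 - 1 = m + 1 by ring,
      pathCount_sub_eq_zero m (h := (m : ℤ) + 1) (by omega), add_sub_cancel_right]
    omega

theorem pathFunctional_shiftedV_mul (n m : ℕ) :
    pathFunctional (shiftedV n * X ^ m) = pathCount m n - pathCount m ((n : ℤ) - 1) := by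
  rw [shiftedV, sub_mul, map_sub, pathFunctional_shiftedS_mul]
  congr 1
  rcases n with _ | n
  · rw [Nat.cast_zero, zero_sub, shiftedS_neg_one, pathCount_of_neg _ (by norm_num)]
    simp
  · rw [Nat.cast_succ, add_sub_cancel_right, pathFunctional_shiftedS_mul]

/-- The index in `{0, …, d - 1}` to which `m` is folded by reflections. -/
def residueIndex (d m : ℕ) : ℕ := if Even (m / d) then m % d else d - 1 - m % d

theorem residueIndex_lt {d : ℕ} (hd : 0 < d) (m : ℕ) : residueIndex d m < d := by
  have := Nat.mod_lt m hd
  unfold residueIndex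
  split_ifs <;> omega

theorem det_motzkinPrefix (n k : ℕ) :
    (Matrix.of fun i j : Fin n => (motzkinPrefix ((i : ℕ) + (j : ℕ) + 1) k : ℤ)).det =
      (-1) ^ (n * (k + 1)) * (rankOneShift
        (fun i : Fin (k + 1) => ⟨residueIndex (k + 1) (n + i), residueIndex_lt k.succ_pos _⟩)
        fun i => residueCoeff (k + 1) ((n + i) / (k + 1)) ((n + i) % (k + 1))).det := by
  obtain ⟨hd, hm⟩ := shiftedS_natDegree_and_monic k
  rw [← det_hankel_mul pathFunctional (fun n => shiftedV n)
    (fun n => (shiftedV_natDegree_and_monic n).2) (fun n => (shiftedV_natDegree_and_monic n).1)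
    (fun n j hj => ?_) (fun n => ?_) (X * shiftedS k) (monic_X.mul hm) n (k + 1) ?_ _ fun i => ?_]
  · congr 2
    ext i j
    rw [show X * shiftedS k * X ^ ((i : ℕ) + (j : ℕ)) = shiftedS k * X ^ ((i : ℕ) + (j : ℕ) + 1) by
      ring, pathFunctional_shiftedS_mul, motzkinPrefix_eq_pathCount]
  · rw [monic_X.natDegree_mul hm, natDegree_X, hd, add_comm]
  · rw [pathFunctional_shiftedV_mul, pathCount_sub_eq_zero j (by exact_mod_cast hj), sub_self]
  · rw [pathFunctional_shiftedV_mul, pathCount_self]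
    push_cast
    ring
  · have h := dvd_shiftedV (k + 1) ((n + i) / (k + 1)) ((n + i) % (k + 1))
      (Nat.mod_lt _ k.succ_pos)
    rw [Nat.div_add_mod', Nat.cast_succ, add_sub_cancel_right] at h
    convert h using 2
    have hs := sum_shiftedV (k + 1)
    rw [Nat.cast_succ, add_sub_cancel_right] at hs
    rw [← hs, ← Fin.sum_univ_eq_sum_range (fun i => shiftedV i)]
    simp only [rankOneShift, Matrix.of_apply, add_smul, Finset.sum_add_distrib, Finset.smul_sum,
      ite_smul, one_smul, zero_smul, Finset.sum_ite_eq, Finset.mem_univ, if_true]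
    rfl

theorem revPerm_pow_val (d q : ℕ) (i : Fin d) :
    (((Fin.revPerm : Equiv.Perm (Fin d)) ^ q) i : ℕ) = if Even q then (i : ℕ) else d - 1 - i := by
  induction q with
  | zero => simp
  | succ q ih =>
    rw [pow_succ', Equiv.Perm.mul_apply, Fin.revPerm_apply, Fin.val_rev, ih]
    have := i.2
    simp only [Nat.even_add_one]
    split_ifs <;> omega

theorem neg_one_pow_mul_choose_two (q d : ℕ) :
    (-1 : ℤ) ^ (q * d) * (-1) ^ (q * d.choose 2) = (-1) ^ (q * (d + 1).choose 2) := by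
  rw [← pow_add, ← mul_add, Nat.choose_succ_succ' d 1, Nat.choose_one_right]

theorem sign_revPerm_pow (d q : ℕ) :
    ((Equiv.Perm.sign ((Fin.revPerm : Equiv.Perm (Fin d)) ^ q) : ℤˣ) : ℤ) =
      (-1) ^ (q * d.choose 2) := by
  rw [map_pow, sign_revPerm]
  push_cast
  rw [← pow_mul, mul_comm]

theorem residueIndex_mul_add {d q r : ℕ} (hr : r < d) :
    residueIndex d (d * q + r) = if Even q then r else d - 1 - r := by
  rw [residueIndex, Nat.mul_add_mod, Nat.mod_eq_of_lt hr, Nat.mul_add_div (by omega),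
    Nat.div_eq_of_lt hr, add_zero]

theorem residueCoeff_div_mod {d q r : ℕ} (hr : r < d) :
    residueCoeff d ((d * q + r) / d) ((d * q + r) % d) = residueCoeff d q r := by
  rw [Nat.mul_add_mod, Nat.mod_eq_of_lt hr, Nat.mul_add_div (by omega), Nat.div_eq_of_lt hr,
    add_zero]

theorem det_motzkinPrefix_of_dvd (k q : ℕ) :
    (Matrix.of fun i j : Fin ((k + 1) * q) =>
        (motzkinPrefix ((i : ℕ) + (j : ℕ) + 1) k : ℤ)).det =
      (-1) ^ (q * (k + 2).choose 2) * (1 + ∑ r ∈ Finset.range (k + 1), residueCoeff (k + 1) q r) := by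
  rw [det_motzkinPrefix]
  have h : (fun i : Fin (k + 1) => (⟨residueIndex (k + 1) ((k + 1) * q + i),
      residueIndex_lt k.succ_pos _⟩ : Fin (k + 1))) =
      ((Fin.revPerm : Equiv.Perm (Fin (k + 1))) ^ q : Equiv.Perm (Fin (k + 1))) := by
    ext i
    rw [revPerm_pow_val]
    exact residueIndex_mul_add i.2
  have h2 : ((-1 : ℤ) ^ ((k + 1) * q * (k + 1))) = (-1) ^ (q * (k + 1)) := by
    rw [show (k + 1) * q * (k + 1) = q * (k * (k + 1)) + q * (k + 1) by ring, pow_add,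
      ((Nat.even_mul_succ_self k).mul_left q).neg_one_pow, one_mul]
  rw [h, det_rankOneShift_perm, sign_revPerm_pow, ← mul_assoc, h2, neg_one_pow_mul_choose_two,
    ← Fin.sum_univ_eq_sum_range]
  congr 2
  exact Finset.sum_congr rfl fun i _ => residueCoeff_div_mod i.2

/-- The rows carry the residues `1, …, k` of block `q` and the residue 0 of block `q + 1`, which
folds onto the same index as residue `k` of block `q`. Giving the last row the missing index yields
the reversal power composed with a rotation. -/
theorem det_motzkinPrefix_mul_add_one {k : ℕ} (hk : 0 < k) (q : ℕ) :
    (Matrix.of fun i j : Fin ((k + 1) * q + 1) =>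
        (motzkinPrefix ((i : ℕ) + (j : ℕ) + 1) k : ℤ)).det =
      -(-1) ^ (q * (k + 2).choose 2) *
        (residueCoeff (k + 1) (q + 1) 0 - residueCoeff (k + 1) q k) := by
  have hlast : (k + 1) * q + 1 + k = (k + 1) * (q + 1) + 0 := by ring
  rw [det_motzkinPrefix, det_rankOneShift_of_repeat
    ((Fin.revPerm : Equiv.Perm (Fin (k + 1))) ^ q * finRotate (k + 1)) _ _
    (i₀ := Fin.last k) (i₁ := ⟨k - 1, by omega⟩)]
  · have h2 : ((-1 : ℤ) ^ (((k + 1) * q + 1) * (k + 1))) = (-1) ^ (q * (k + 1)) * (-1) ^ (k + 1) := by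
      rw [show ((k + 1) * q + 1) * (k + 1) = q * (k * (k + 1)) + q * (k + 1) + (k + 1) by ring,
        pow_add, pow_add, ((Nat.even_mul_succ_self k).mul_left q).neg_one_pow, one_mul]
    have h3 : ((-1 : ℤ) ^ k) * (-1) ^ k = 1 := by rw [← mul_pow]; simp
    have e1 : (k + 1) * q + 1 + (k - 1) = (k + 1) * q + k := by omega
    rw [map_mul, sign_finRotate, Units.val_mul, sign_revPerm_pow, h2,
      ← neg_one_pow_mul_choose_two q (k + 1), Fin.val_last, hlast,
      residueCoeff_div_mod k.succ_pos, e1, residueCoeff_div_mod k.lt_succ_self,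
      Nat.add_sub_cancel]
    push_cast
    linear_combination (-(-1) ^ (q * (k + 1)) * (-1) ^ (q * (k + 1).choose 2) *
      (residueCoeff (k + 1) (q + 1) 0 - residueCoeff (k + 1) q k) : ℤ) * h3
  · intro h
    have := congrArg Fin.val h
    simp only [Fin.val_last] at this
    omega
  · ext
    rw [Equiv.Perm.mul_apply, revPerm_pow_val, coe_finRotate_of_ne_last
      (fun h => by have := congrArg Fin.val h; simp only [Fin.val_last] at this; omega)]
    simp only [Fin.val_last, hlast, residueIndex_mul_add k.succ_pos, Nat.even_add_one]
    split_ifs <;> omega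
  · intro i hi
    have hi' : (i : ℕ) < k := Fin.val_lt_last hi
    ext
    rw [Equiv.Perm.mul_apply, revPerm_pow_val, coe_finRotate_of_ne_last hi]
    have e : (k + 1) * q + 1 + i = (k + 1) * q + (i + 1) := by ring
    simp only [e, residueIndex_mul_add (show (i : ℕ) + 1 < k + 1 by omega)]

/-- Here row 0 has residue `k` of block `q`, and the others have residues `0, …, k-1` of block `q +
1`. Rows 0 and 1 share an index, and the rotation is inverted. -/
theorem det_motzkinPrefix_mul_add_self {k : ℕ} (hk : 0 < k) (q : ℕ) :
    (Matrix.of fun i j : Fin ((k + 1) * q + k) =>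
        (motzkinPrefix ((i : ℕ) + (j : ℕ) + 1) k : ℤ)).det =
      (-1) ^ ((q + 1) * (k + 2).choose 2) *
        (residueCoeff (k + 1) (q + 1) 0 - residueCoeff (k + 1) q k) := by
  have hsucc : ∀ i : ℕ, (k + 1) * q + k + (i + 1) = (k + 1) * (q + 1) + i := fun i => by ring
  rw [det_motzkinPrefix, det_rankOneShift_of_repeat
    ((Fin.revPerm : Equiv.Perm (Fin (k + 1))) ^ (q + 1) * (finRotate (k + 1))⁻¹) _ _
    (i₀ := 0) (i₁ := ⟨0 + 1, by omega⟩)]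
  · have h2 : ((-1 : ℤ) ^ (((k + 1) * q + k) * (k + 1))) = (-1) ^ (q * (k + 1)) := by
      rw [show ((k + 1) * q + k) * (k + 1) = (q + 1) * (k * (k + 1)) + q * (k + 1) by ring,
        pow_add, ((Nat.even_mul_succ_self k).mul_left (q + 1)).neg_one_pow, one_mul]
    rw [map_mul, Equiv.Perm.sign_inv, sign_finRotate, Units.val_mul, sign_revPerm_pow, h2,
      ← neg_one_pow_mul_choose_two (q + 1) (k + 1), hsucc, residueCoeff_div_mod k.succ_pos,
      Fin.val_zero, add_zero, residueCoeff_div_mod k.lt_succ_self, Nat.add_sub_cancel]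
    push_cast
    ring
  · intro h
    simpa using congrArg Fin.val h
  · ext
    rw [Equiv.Perm.mul_apply, revPerm_pow_val]
    have h : (finRotate (k + 1))⁻¹ ⟨0 + 1, by omega⟩ = 0 := by
      rw [Equiv.Perm.inv_eq_iff_eq]
      ext
      rw [coe_finRotate_of_ne_last
        (fun h => by have := congrArg Fin.val h; simp only [Fin.val_last] at this; simp at this; omega)]
      simp
    rw [h]
    simp only [Fin.val_zero, add_zero, residueIndex_mul_add k.lt_succ_self, Nat.even_add_one]
    split_ifs <;> omega
  · intro i hi
    obtain ⟨j, rfl⟩ := Fin.exists_succ_eq.2 hi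
    ext
    have h : (finRotate (k + 1))⁻¹ j.succ = j.castSucc := by
      rw [Equiv.Perm.inv_eq_iff_eq]
      ext
      rw [coe_finRotate_of_ne_last (Fin.castSucc_lt_last j).ne]
      simp
    rw [Equiv.Perm.mul_apply, revPerm_pow_val, h]
    simp only [Fin.val_succ, hsucc, residueIndex_mul_add (show (j : ℕ) < k + 1 by omega),
      Fin.val_castSucc]

/-- Around the boundary between blocks `q` and `q + 1`, the two adjacent rows fold together, and so
do their outer neighbours; the bounds on `r` ensure that all four rows exist. -/
theorem det_motzkinPrefix_eq_zero {k r : ℕ} (hr : 2 ≤ r) (hrk : r < k) (q : ℕ) :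
    (Matrix.of fun i j : Fin ((k + 1) * q + r) =>
        (motzkinPrefix ((i : ℕ) + (j : ℕ) + 1) k : ℤ)).det = 0 := by
  rw [det_motzkinPrefix, det_rankOneShift_eq_zero _ _ (i₀ := ⟨k - r, by omega⟩)
    (i₁ := ⟨k - r + 1, by omega⟩) (i₂ := ⟨k - r - 1, by omega⟩) (i₃ := ⟨k - r + 2, by omega⟩),
    mul_zero]
  iterate 4 simp only [ne_eq, Fin.mk.injEq]; omega
  · ext
    simp only [show (k + 1) * q + r + (k - r) = (k + 1) * q + k by omega,
      show (k + 1) * q + r + (k - r + 1) = (k + 1) * (q + 1) + 0 by rw [mul_add]; omega,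
      residueIndex_mul_add k.succ_pos, residueIndex_mul_add k.lt_succ_self, Nat.even_add_one]
    split_ifs <;> omega
  · ext
    simp only [show (k + 1) * q + r + (k - r - 1) = (k + 1) * q + (k - 1) by omega,
      show (k + 1) * q + r + (k - r + 2) = (k + 1) * (q + 1) + 1 by rw [mul_add]; omega,
      residueIndex_mul_add (show 1 < k + 1 by omega),
      residueIndex_mul_add (show k - 1 < k + 1 by omega), Nat.even_add_one]
    split_ifs <;> omega

/-! ### Evaluation of the rank-one coefficients. -/

theorem sum_residueCoeff_add_two (d q : ℕ) :
    ∑ r ∈ Finset.range d, residueCoeff d (q + 2) r = ∑ r ∈ Finset.range d, residueCoeff d q r +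
      (cubicTrace ((q + 2) * d) - cubicTrace ((q + 1) * d)) := by
  simp only [residueCoeff, Finset.sum_add_distrib]
  have h := Finset.sum_range_sub (fun r => cubicTrace ((q + 1) * d + r)) d
  simp only [← add_assoc, add_zero] at h
  rw [h, show (q + 1) * d + d = (q + 2) * d by ring]

theorem sum_residueCoeff_one (d : ℕ) :
    ∑ r ∈ Finset.range d, residueCoeff d 1 r = cubicTrace d - 2 := by
  simp only [residueCoeff]
  exact Finset.sum_range_sub cubicTrace d

theorem cubicTrace_mul {d : ℕ} (hd : d % 3 ≠ 0) (q : ℕ) : cubicTrace (q * d) = cubicTrace q := by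
  have h : q * d % 3 = 0 ↔ q % 3 = 0 := by
    rw [← Nat.dvd_iff_mod_eq_zero, ← Nat.dvd_iff_mod_eq_zero, Nat.prime_three.dvd_mul]
    exact or_iff_left fun h => hd (Nat.dvd_iff_mod_eq_zero.1 h)
  simp only [cubicTrace, h]

theorem cubicTrace_mul_of_dvd {d : ℕ} (hd : d % 3 = 0) (q : ℕ) : cubicTrace (q * d) = 2 :=
  if_pos (by rw [Nat.mul_mod, hd, mul_zero, Nat.zero_mod])

theorem sum_residueCoeff_of_dvd {d : ℕ} (hd : d % 3 = 0) (q : ℕ) :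
    ∑ r ∈ Finset.range d, residueCoeff d q r = 0 := by
  induction q using Nat.twoStepInduction with
  | zero => simp [residueCoeff]
  | one =>
    rw [sum_residueCoeff_one, cubicTrace, if_pos hd, sub_self]
  | more q ih _ =>
    rw [sum_residueCoeff_add_two, ih, cubicTrace_mul_of_dvd hd, cubicTrace_mul_of_dvd hd]
    simp

theorem sum_residueCoeff_of_not_dvd {d : ℕ} (hd : d % 3 ≠ 0) (q : ℕ) :
    ∑ r ∈ Finset.range d, residueCoeff d q r = if q % 3 = 1 then -3 else 0 := by
  induction q using Nat.twoStepInduction with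
  | zero => simp [residueCoeff]
  | one =>
    rw [sum_residueCoeff_one, cubicTrace, if_neg hd]
    norm_num
  | more q ih _ =>
    rw [sum_residueCoeff_add_two, ih, cubicTrace_mul hd, cubicTrace_mul hd]
    simp only [cubicTrace]
    split_ifs <;> omega

/-- The increment is a second difference of `cubicTrace`, equal to `-3` times its value at `(q + 2)
* (k + 1)`. That value is always 2 if 3 divides `k + 1`, whence linear growth, and otherwise depends
on `q` modulo 3. -/
theorem residueCoeff_jump_add_two (k q : ℕ) :
    residueCoeff (k + 1) (q + 3) 0 - residueCoeff (k + 1) (q + 2) k =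
      residueCoeff (k + 1) (q + 1) 0 - residueCoeff (k + 1) q k +
      (cubicTrace ((q + 2) * (k + 1) + 1) - 2 * cubicTrace ((q + 2) * (k + 1)) +
        cubicTrace ((q + 1) * (k + 1) + k)) := by
  have e : (q + 1) * (k + 1) + k + 1 = (q + 2) * (k + 1) := by ring
  simp only [residueCoeff, e]
  ring_nf

theorem residueCoeff_jump_zero (k : ℕ) :
    residueCoeff (k + 1) 1 0 - residueCoeff (k + 1) 0 k = -3 := by
  simp [residueCoeff, cubicTrace]

theorem residueCoeff_jump_one (k : ℕ) :
    residueCoeff (k + 1) 2 0 - residueCoeff (k + 1) 1 k =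
      cubicTrace (k + 2) - 2 * cubicTrace (k + 1) + cubicTrace k := by
  simp only [residueCoeff, zero_add, one_mul, add_zero]
  ring

theorem residueCoeff_jump_of_mod_eq_two {k : ℕ} (hk : k % 3 = 2) (q : ℕ) :
    residueCoeff (k + 1) (q + 1) 0 - residueCoeff (k + 1) q k = -3 * (q + 1) := by
  induction q using Nat.twoStepInduction with
  | zero => simpa using residueCoeff_jump_zero k
  | one =>
    rw [residueCoeff_jump_one]
    simp only [cubicTrace]
    split_ifs <;> omega
  | more q ih _ =>
    have h1 : (q + 2) * (k + 1) % 3 = 0 := by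
      rw [Nat.mul_mod, show (k + 1) % 3 = 0 by omega, mul_zero, Nat.zero_mod]
    have h2 : ((q + 1) * (k + 1) + k) % 3 = 2 := by
      rw [Nat.add_mod, Nat.mul_mod, show (k + 1) % 3 = 0 by omega, hk, mul_zero, Nat.zero_mod]
    rw [residueCoeff_jump_add_two, ih]
    simp only [cubicTrace]
    rw [if_neg (by omega), if_pos h1, if_neg (by omega)]
    push_cast
    ring

theorem residueCoeff_jump_of_mod_ne_two {k : ℕ} (hk : k % 3 ≠ 2) (q : ℕ) :
    residueCoeff (k + 1) (q + 1) 0 - residueCoeff (k + 1) q k =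
      if q % 3 = 0 then -3 else if q % 3 = 1 then 3 else 0 := by
  induction q using Nat.twoStepInduction with
  | zero => simpa using residueCoeff_jump_zero k
  | one =>
    rw [residueCoeff_jump_one]
    simp only [cubicTrace]
    split_ifs <;> first | contradiction | omega
  | more q ih _ =>
    have h1 : (q + 2) * (k + 1) % 3 = 0 ↔ (q + 2) % 3 = 0 := by
      rw [← Nat.dvd_iff_mod_eq_zero, ← Nat.dvd_iff_mod_eq_zero, Nat.prime_three.dvd_mul]
      exact or_iff_left fun h => by omega
    have h2 : (q + 1) * (k + 1) + k + 1 = (q + 2) * (k + 1) := by ring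
    rw [residueCoeff_jump_add_two, ih]
    simp only [cubicTrace]
    split_ifs <;> omega

end

/-! ### Assembly of the cases. -/

theorem neg_one_pow_three_mul_add (q j b : ℕ) :
    (-1 : ℤ) ^ ((3 * q + j) * b) = (-1) ^ ((q + j) * b) := by
  rw [show (3 * q + j) * b = 2 * (q * b) + (q + j) * b by ring, pow_add, pow_mul]
  simp

theorem neg_one_pow_add_two_mul (q b : ℕ) : (-1 : ℤ) ^ ((q + 2) * b) = (-1) ^ (q * b) := by
  rw [show (q + 2) * b = 2 * b + q * b by ring, pow_add, pow_mul]
  simp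

theorem corollary16 (n k : ℕ) (hn : 0 < n) :
    (Matrix.of fun i j : Fin n => (motzkinPrefix ((i : ℕ) + (j : ℕ) + 1) k : ℤ)).det =
      (Matrix.of fun i j : Fin n => (trinomialSum ((i : ℕ) + (j : ℕ) + 1) k : ℤ)).det ∧
    (Matrix.of fun i j : Fin n => (motzkinPrefix ((i : ℕ) + (j : ℕ) + 1) k : ℤ)).det =
      if n % (k + 1) = 0 ∧ k % 3 = 2 then
        (-1) ^ (n / (k + 1) * (k + 2).choose 2)
      else if n % (3 * k + 3) = 0 ∧ k % 3 ≠ 2 then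
        (-1) ^ (n / (3 * k + 3) * (k + 2).choose 2)
      else if n % (3 * k + 3) = k + 1 ∧ k % 3 ≠ 2 then
        2 * (-1) ^ ((n / (3 * k + 3) + 1) * (k + 2).choose 2 + 1)
      else if n % (3 * k + 3) = 2 * k + 2 ∧ k % 3 ≠ 2 then
        (-1) ^ (n / (3 * k + 3) * (k + 2).choose 2)
      else if n % (k + 1) = 1 ∧ k % 3 = 2 then
        3 * (-1) ^ (n / (k + 1) * (k + 2).choose 2) * (((n / (k + 1) : ℕ) : ℤ) + 1)
      else if n % (3 * k + 3) = 1 ∧ k % 3 ≠ 2 then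
        3 * (-1) ^ (n / (3 * k + 3) * (k + 2).choose 2)
      else if n % (3 * k + 3) = k + 2 ∧ k % 3 ≠ 2 then
        3 * (-1) ^ ((n / (3 * k + 3) + 1) * (k + 2).choose 2 + 1)
      else if n % (k + 1) = k ∧ k % 3 = 2 then
        3 * (-1) ^ ((n / (k + 1) + 1) * (k + 2).choose 2 + 1) * (((n / (k + 1) : ℕ) : ℤ) + 1)
      else if n % (3 * k + 3) = k ∧ k % 3 ≠ 2 then
        3 * (-1) ^ ((n / (3 * k + 3) + 1) * (k + 2).choose 2 + 1)
      else if n % (3 * k + 3) = 2 * k + 1 ∧ k % 3 ≠ 2 then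
        3 * (-1) ^ (n / (3 * k + 3) * (k + 2).choose 2)
      else 0 := by
  refine ⟨by simp only [motzkinPrefix_eq_trinomialSum], ?_⟩
  clear hn
  obtain ⟨q, r, hr, rfl⟩ : ∃ q r, r < k + 1 ∧ n = (k + 1) * q + r :=
    ⟨n / (k + 1), n % (k + 1), Nat.mod_lt _ k.succ_pos, (Nat.div_add_mod _ _).symm⟩
  have hmod : ((k + 1) * q + r) % (k + 1) = r := by rw [Nat.mul_add_mod, Nat.mod_eq_of_lt hr]
  have hdiv : ((k + 1) * q + r) / (k + 1) = q := by
    rw [Nat.mul_add_div k.succ_pos, Nat.div_eq_of_lt hr, add_zero]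
  by_cases hk : k % 3 = 2
  · have hk' : (k + 1) % 3 = 0 := by omega
    simp only [hk, hmod, hdiv, and_true, ne_eq, not_true_eq_false, and_false, if_false]
    have jump := residueCoeff_jump_of_mod_eq_two hk q
    by_cases h0 : r = 0
    · subst h0
      rw [if_pos rfl]
      exact (det_motzkinPrefix_of_dvd k q).trans (by rw [sum_residueCoeff_of_dvd hk']; ring)
    rw [if_neg h0]
    by_cases h1 : r = 1
    · subst h1
      rw [if_pos rfl, det_motzkinPrefix_mul_add_one (by omega), jump]
      ring
    rw [if_neg h1]
    by_cases h2 : r = k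
    · subst h2
      rw [if_pos rfl, det_motzkinPrefix_mul_add_self (by omega), jump]
      ring
    rw [if_neg h2, det_motzkinPrefix_eq_zero (by omega) (by omega)]
  · have hk' : (k + 1) % 3 ≠ 0 := by omega
    have jump := residueCoeff_jump_of_mod_ne_two hk q
    have hsum := sum_residueCoeff_of_not_dvd hk' q
    -- Three blocks of length `k + 1` make one period `3k + 3`: `p` is the quotient in the
    -- statement, and `j` tells which block of the period contains `n`.
    obtain ⟨p, j, hj, rfl⟩ : ∃ p j, j < 3 ∧ q = 3 * p + j :=
      ⟨q / 3, q % 3, Nat.mod_lt _ (by norm_num), (Nat.div_add_mod _ _).symm⟩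
    have hj3 : (3 * p + j) % 3 = j := by omega
    have hlt : (k + 1) * j + r < 3 * k + 3 := by
      have : (k + 1) * j ≤ (k + 1) * 2 := Nat.mul_le_mul_left _ (by omega)
      omega
    have hn : (k + 1) * (3 * p + j) + r = (3 * k + 3) * p + ((k + 1) * j + r) := by ring
    have hmod3 : ((k + 1) * (3 * p + j) + r) % (3 * k + 3) = (k + 1) * j + r := by
      rw [hn, Nat.mul_add_mod, Nat.mod_eq_of_lt hlt]
    have hdiv3 : ((k + 1) * (3 * p + j) + r) / (3 * k + 3) = p := by
      rw [hn, Nat.mul_add_div (by omega), Nat.div_eq_of_lt hlt, add_zero]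
    rw [hj3] at jump hsum
    simp only [hk, hmod3, hdiv3, and_true, ne_eq, not_false_eq_true, and_false, if_false]
    clear hmod3 hdiv3 hn hmod hdiv
    by_cases h0 : r = 0
    · subst h0
      refine (det_motzkinPrefix_of_dvd k (3 * p + j)).trans ?_
      rw [hsum, neg_one_pow_three_mul_add]
      interval_cases j
      · rw [if_neg (by omega), if_pos (by omega)]
        simp
      · rw [if_pos (by omega), if_neg (by omega), if_pos (by omega)]
        ring
      · rw [if_neg (by omega), if_neg (by omega), if_neg (by omega), if_pos (by omega), neg_one_pow_add_two_mul]
        simp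
    have hk0 : 0 < k := by omega
    by_cases h1 : r = 1
    · subst h1
      rw [det_motzkinPrefix_mul_add_one hk0, jump, neg_one_pow_three_mul_add]
      interval_cases j
      · rw [if_pos (by omega), if_neg (by omega), if_neg (by omega), if_neg (by omega), if_pos (by omega)]
        ring
      · rw [if_neg (by omega), if_pos (by omega), if_neg (by omega), if_neg (by omega), if_neg (by omega), if_neg (by omega),
          if_pos (by omega)]
        ring
      · rw [if_neg (by omega), if_neg (by omega), if_neg (by omega), if_neg (by omega), if_neg (by omega), if_neg (by omega),
          if_neg (by omega), if_neg (by omega), if_neg (by omega)]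
        norm_num
    by_cases h2 : r = k
    · subst h2
      rw [det_motzkinPrefix_mul_add_self hk0, jump,
        show 3 * p + j + 1 = 3 * p + (j + 1) by ring, neg_one_pow_three_mul_add]
      interval_cases j
      · rw [if_pos (by omega), if_neg (by omega), if_neg (by omega), if_neg (by omega), if_neg (by omega),
          if_neg (by omega), if_pos (by omega)]
        ring
      · rw [if_neg (by omega), if_pos (by omega), if_neg (by omega), if_neg (by omega), if_neg (by omega), if_neg (by omega),
          if_neg (by omega), if_neg (by omega), if_pos (by omega),
          one_add_one_eq_two, neg_one_pow_add_two_mul]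
        ring
      · rw [if_neg (by omega), if_neg (by omega), if_neg (by omega), if_neg (by omega), if_neg (by omega), if_neg (by omega),
          if_neg (by omega), if_neg (by omega), if_neg (by omega)]
        norm_num
    rw [det_motzkinPrefix_eq_zero (by omega) (by omega)]
    interval_cases j <;>
    rw [if_neg (by omega), if_neg (by omega), if_neg (by omega), if_neg (by omega),
      if_neg (by omega), if_neg (by omega), if_neg (by omega)]
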